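/- Banach spaces are real. Let $\omega_1$ be the first uncountable ordinal and $B_X$ the closed unit ball of $X$. Given a map $D$ on subsets of some set, put $D^0(A)=A$, $D^{\xi+1}(A)=D(D^\xi(A))$ and $D^\xi(A)=\bigcap_{\zeta<\xi}D^\zeta(A)$ for limit $\xi$; the index of $A$ under $D$ is the least $\xi<\omega_1$ with $D^\xi(A)=\varnothing$, and $\omega_1$ if there is none. For $L\subset X^*$ bounded and $\varepsilon>0$, let $s_\varepsilon(L)$ be the set of $x^*\in X^*$ such that $\operatorname{diam}_{\|\cdot\|}(V\cap L)>\varepsilon$ for every $w^*$-neighborhood $V$ of $x^*$; let $Sz_\varepsilon(L)$ be the index of $L$ under $s_\varepsilon$, $Sz(L)=\sup_{\varepsilon>0}Sz_\varepsilon(L)$, and $Sz(X)=Sz(B_{X^*})$. For $\varnothing\neq K\subset X^*$ and $\varepsilon>0$, let $\mathcal{H}^K_\varepsilon$ be the set of all finite sequences $(x_i)_{i=1}^n$ in $B_X$ (including the empty one) for which there is $x^*\in K$ with $x^*(x_i)\geq\varepsilon$ for all $i$. For $\varnothing\neq S\subset X^*$ and a set $\mathcal{H}$ of finite sequences in $X$,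 let $(\mathcal{H})'_S$ be the set of $t\in\mathcal{H}$ for which there is a sequence $(s_i)_{i=1}^\infty$ in $B_X$ with $x^*(s_i)\to0$ for every $x^*\in S$ such that the concatenation $t^\frown s_i$ is in $\mathcal{H}$ for every $i$; let $I_S(\mathcal{H})$ be the index of $\mathcal{H}$ under $\mathcal{H}\mapsto(\mathcal{H})'_S$. Let $\oplus$ denote the Hessenberg (natural) sum of ordinals, obtained by adding Cantor normal forms coefficientwise. **Theorem.** 1. Let $X$ be a separable Banach space, $\varepsilon>0$, and let $K,L,S\subset X^*$ be non-empty and norm separable, with $K,L$ $w^*$-compact. Then $$I_S(\mathcal{H}^{K+L}_\varepsilon)\leq I_S(\mathcal{H}^K_{\varepsilon/2})\oplus I_S(\mathcal{H}^L_{\varepsilon/2}).$$ 2. Let $X$ be a separable Banach space and let $K,L\subset X^*$ be non-empty, norm separable, $w^*$-compact and convex. Then $Sz(K+L)=\max\{Sz(K),Sz(L)\}$. 3. For any separable Banach spaces $Y,Z$, $Sz(Y\oplus Z)=\max\{Sz(Y),Sz(Z)\}$, where $Y\oplus Z$ carries any norm inducing the product topology (more generally, $Sz(W)=\max\{Sz(Y),Sz(Z)\}$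 for every normed space $W$ linearly homeomorphic to $Y\times Z$). -/

import Mathlib

open scoped Pointwise Topology Ordinal

noncomputable section

/-- Transfinite iteration of a derivation `D` on subsets of `α`, starting from `A`:
`A` at stage `0`, apply `D` at successor stages, intersect all earlier stages at limit stages. -/
def iterDeriv {α : Type*} (D : Set α → Set α) (A : Set α) (ξ : Ordinal.{0}) : Set α :=
  Ordinal.limitRecOn ξ A (fun _ B => D B) (fun η _ B => ⋂ ζ : Set.Iio η, B ζ.1 ζ.2)

theorem iterDeriv_zero {α : Type*} (D : Set α → Set α) (A : Set α) :
    iterDeriv D A 0 = A := by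
  simp [iterDeriv]

theorem iterDeriv_add_one {α : Type*} (D : Set α → Set α) (A : Set α) (ξ : Ordinal.{0}) :
    iterDeriv D A (ξ + 1) = D (iterDeriv D A ξ) := by
  simp [iterDeriv]

theorem iterDeriv_limit {α : Type*} (D : Set α → Set α) (A : Set α) (ξ : Ordinal.{0})
    (h : Order.IsSuccLimit ξ) :
    iterDeriv D A ξ = ⋂ ζ : Set.Iio ξ, iterDeriv D A ζ.1 := by
  simp [iterDeriv, h]

/-- The index of a derivation: the least `ξ < ω₁` at which the iteration started at `A` is empty,
and `ω₁` if there is no such `ξ`. -/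
def derivIndex {α : Type*} (D : Set α → Set α) (A : Set α) : Ordinal.{0} :=
  sInf (insert ω₁ {ξ : Ordinal.{0} | ξ < ω₁ ∧ iterDeriv D A ξ = ∅})

/-- The Hessenberg (natural) sum: add the Cantor normal forms coefficientwise. -/
def hessenbergSum (a b : Ordinal.{0}) : Ordinal.{0} :=
  Ordinal.CNF.eval ω (Ordinal.CNF.coeff ω a + Ordinal.CNF.coeff ω b)

section Banach

variable {X : Type*} [NormedAddCommGroup X] [NormedSpace ℝ X]

/-- `K` is compact in the weak* topology of the dual of `X`. -/
def IsWeakStarCompact (K : Set (StrongDual ℝ X)) : Prop :=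
  IsCompact (StrongDual.toWeakDual '' K)

/-- The Szlenk derivation: the functionals all of whose weak* neighborhoods meet `L` in a set of
norm diameter greater than `ε`. -/
def szlenkDeriv (ε : ℝ) (L : Set (StrongDual ℝ X)) : Set (StrongDual ℝ X) :=
  {f | ∀ V ∈ 𝓝 (StrongDual.toWeakDual f),
    ENNReal.ofReal ε < Metric.ediam ((StrongDual.toWeakDual ⁻¹' V : Set (StrongDual ℝ X)) ∩ L)}

/-- The `ε`-Szlenk index of a set of functionals. -/
def szlenkIndexAt (ε : ℝ) (L : Set (StrongDual ℝ X)) : Ordinal.{0} :=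
  derivIndex (szlenkDeriv ε) L

/-- The Szlenk index of a set of functionals: the supremum over `ε > 0` of its `ε`-Szlenk
indices. -/
def szlenkIndex (L : Set (StrongDual ℝ X)) : Ordinal.{0} :=
  ⨆ ε : Set.Ioi (0 : ℝ), szlenkIndexAt ε.1 L

variable (X) in
/-- The Szlenk index of a Banach space is that of the closed unit ball of its dual. -/
def spaceSzlenkIndex : Ordinal.{0} :=
  szlenkIndex (Metric.closedBall (0 : StrongDual ℝ X) 1)

/-- The sequences in the closed unit ball of `X` that are pointwise null on `S`. -/
def nullSequences (S : Set (StrongDual ℝ X)) : Set (ℕ → X) :=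
  {s | (∀ n, ‖s n‖ ≤ 1) ∧ ∀ f ∈ S, Filter.Tendsto (fun n => f (s n)) Filter.atTop (𝓝 0)}

/-- The derivation on trees of finite sequences associated with a set `σ` of infinite
sequences. -/
def seqDeriv {α : Type*} (σ : Set (ℕ → α)) (H : Set (List α)) : Set (List α) :=
  {t ∈ H | ∃ s ∈ σ, ∀ i, t ++ [s i] ∈ H}

/-- The `S`-null index `I_S` of a tree of finite sequences in `X`. -/
def nullIndex (S : Set (StrongDual ℝ X)) (H : Set (List X)) : Ordinal.{0} :=
  derivIndex (seqDeriv (nullSequences S)) H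

/-- The tree `ℋ^K_ε` of finite sequences in the closed unit ball of `X` on all of whose terms
some single `f ∈ K` is at least `ε`. -/
def ballTree (K : Set (StrongDual ℝ X)) (ε : ℝ) : Set (List X) :=
  {t | (∀ x ∈ t, ‖x‖ ≤ 1) ∧ ∃ f ∈ K, ∀ x ∈ t, ε ≤ f x}

end Banach

end

/-!
All three parts rest on one counting principle: if a point of `ξ`-fold
derived objects splits into two parts surviving `a` and `b` derivations, then it can be arranged
that `ξ ≤ a ⊕ b`, because each derivation of the whole forces a derivation of one of the parts and
`⊕` is strictly increasing in each variable.

For the trees `ℋ^K_ε` the splitting comes from labels: if `f + g ≥ ε` on the terms of a sequence,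
each term satisfies `f ≥ ε / 2` or `g ≥ ε / 2`. Among the one-term extensions that witness a
derivation, infinitely many carry the same labels, and these witness a derivation of the part that
receives the new terms (`exists_labels_of_mem_iterDeriv`).

For the Szlenk derivation the splitting is the one of a point of a product `K × L`
(`exists_of_mem_iterDeriv_prod`), and there no constants are lost. Hence, if `K` and `L` are weak*
compact with last nonempty `ε`-derived sets of orders `a` and `b`, the `ε`-index of the product is
at most `(a ⊕ b) + 1`. When `K` is convex, `f / 2 + K / 2 ⊆ K` shows that `Sz(K)` is closed under
addition (`isPrincipal_add_szlenkIndex`), so it is a power of `ω` and is not exceeded by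
`(a ⊕ b) + 1`. The sum `K + L` is the image of `K × L` under addition, and derivations of the
continuous Lipschitz image of a compact set are controlled by those of the set
(`iterDeriv_diamDeriv_image_subset`). For `W ≃ Y × Z` the dual ball of `W` embeds in the product of
the dual balls of `Y` and `Z`, by a map that keeps separated points separated
(`mapsTo_iterDeriv_diamDeriv`); such maps also give the lower bounds.
-/

/-! ### The Hessenberg sum -/

namespace Ordinal.CNF

theorem coeff_omega0_lt (o e : Ordinal) : coeff ω o e < ω := by
  by_cases h : e ∈ (CNF ω o).map Prod.fst
  · obtain ⟨⟨e', c⟩, hmem, rfl⟩ := List.mem_map.1 h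
    rw [coeff_of_mem_CNF hmem]
    exact snd_lt one_lt_omega0 hmem
  · rw [coeff_of_notMem_CNF h]
    exact omega0_pos

/-- Evaluation is strictly increasing for the colexicographic order of coefficients: the
coefficients are compared at the largest exponent where they differ. -/
theorem eval_lt_eval_of_lt {b e : Ordinal} {f g : Ordinal →₀ Ordinal} (hf : ∀ x, f x < b)
    (he : f e < g e) (h : ∀ x, e < x → f x = g x) : eval b f < eval b g := by
  have split (k : Ordinal →₀ Ordinal) : eval b k =
      eval b (k.filter (e < ·)) + (b ^ e * k e + eval b (k.filter (· < e))) := by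
    have hk : k = k.filter (e < ·) + (.single e (k e) + k.filter (· < e)) := by
      ext x
      rcases lt_trichotomy x e with hx | rfl | hx
      · simp [hx, hx.not_gt, hx.ne]
      · simp
      · simp [hx, hx.not_gt, hx.ne']
    conv_lhs => rw [hk]
    rw [eval_add, eval_single_add']
    · intro x hx
      simp only [Finsupp.mem_support_iff, Finsupp.filter_apply, ne_eq, ite_eq_right_iff,
        Classical.not_imp] at hx
      exact hx.1
    · intro x hx y hy
      simp only [Finsupp.mem_support_iff, Finsupp.filter_apply, ne_eq, ite_eq_right_iff,
        Classical.not_imp] at hx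
      refine le_trans ?_ hx.1.le
      by_contra! hlt
      apply Finsupp.mem_support_iff.1 hy
      simp [hlt.not_gt, hlt.ne']
  have htop : f.filter (e < ·) = g.filter (e < ·) := by
    ext x
    by_cases hx : e < x <;> simp [hx, h x]
  rw [split f, split g, htop]
  gcongr 1
  have hlow : eval b (f.filter (· < e)) < b ^ e := by
    refine eval_lt (fun x => ?_) fun x hx => ?_
    · by_cases hx : x < e
      · simpa [hx] using hf x
      · simpa [hx] using (hf x).pos
    · simp only [Finsupp.mem_support_iff, Finsupp.filter_apply, ne_eq, ite_eq_right_iff,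
        Classical.not_imp] at hx
      exact hx.1
  calc b ^ e * f e + eval b (f.filter (· < e)) < b ^ e * f e + b ^ e := by gcongr
    _ = b ^ e * (f e + 1) := by rw [mul_add_one]
    _ ≤ b ^ e * g e := by gcongr; exact Order.add_one_le_of_lt he
    _ ≤ _ := le_self_add

/-- A smaller ordinal has the smaller coefficient at the largest exponent where the Cantor normal
forms differ. -/
theorem exists_coeff_lt {a b : Ordinal} (hab : a < b) :
    ∃ e, coeff ω a e < coeff ω b e ∧ ∀ x, e < x → coeff ω a x = coeff ω b x := by
  classical
  have hne : ((coeff ω a).support ∪ (coeff ω b).support).filter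
      (fun x => coeff ω a x ≠ coeff ω b x) |>.Nonempty := by
    by_contra! hempty
    apply hab.ne
    rw [← coeff_inj (b := ω)]
    ext x
    by_contra hx
    have : x ∉ (∅ : Finset Ordinal) := Finset.notMem_empty x
    rw [← hempty] at this
    simp only [Finset.mem_filter, Finset.mem_union, Finsupp.mem_support_iff] at this
    by_cases h0 : coeff ω a x = 0
    · exact this ⟨.inr fun h => hx (h0.trans h.symm), hx⟩
    · exact this ⟨.inl h0, hx⟩
  obtain ⟨e, he, hmax⟩ := Finset.exists_max_image _ id hne
  have heq (x) (hx : e < x) : coeff ω a x = coeff ω b x := by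
    by_contra hne'
    refine (hmax x ?_).not_gt hx
    simp only [Finset.mem_filter, Finset.mem_union, Finsupp.mem_support_iff]
    refine ⟨?_, hne'⟩
    by_contra! h0
    exact hne' (h0.1.trans h0.2.symm)
  refine ⟨e, ?_, heq⟩
  rcases lt_or_gt_of_ne (Finset.mem_filter.1 he).2 with h | h
  · exact h
  · have := eval_lt_eval_of_lt (coeff_omega0_lt b) h fun x hx => (heq x hx).symm
    rw [eval_coeff, eval_coeff] at this
    exact absurd this hab.not_gt

end Ordinal.CNF

open Ordinal Ordinal.CNF

theorem hessenbergSum_comm (a b : Ordinal.{0}) : hessenbergSum a b = hessenbergSum b a := by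
  rw [hessenbergSum, hessenbergSum]
  congr 1
  ext e
  obtain ⟨m, hm⟩ := lt_omega0.1 (coeff_omega0_lt a e)
  obtain ⟨n, hn⟩ := lt_omega0.1 (coeff_omega0_lt b e)
  rw [Finsupp.add_apply, Finsupp.add_apply, hm, hn, ← Nat.cast_add, add_comm, Nat.cast_add]

theorem hessenbergSum_strictMono_left (c : Ordinal.{0}) :
    StrictMono fun a => hessenbergSum a c := by
  intro a b hab
  obtain ⟨e, he, h⟩ := exists_coeff_lt hab
  refine eval_lt_eval_of_lt (b := ω) (e := e)
    (fun x => isPrincipal_add_omega0 (coeff_omega0_lt a x) (coeff_omega0_lt c x)) ?_ fun x hx => ?_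
  · rw [Finsupp.add_apply, Finsupp.add_apply]
    obtain ⟨k, hk⟩ := lt_omega0.1 (coeff_omega0_lt a e)
    obtain ⟨m, hm⟩ := lt_omega0.1 (coeff_omega0_lt b e)
    obtain ⟨n, hn⟩ := lt_omega0.1 (coeff_omega0_lt c e)
    rw [hk, hm] at he
    rw [hk, hm, hn]
    exact_mod_cast Nat.add_lt_add_right (Nat.cast_lt.1 he) n
  · simp [h x hx]

theorem hessenbergSum_strictMono_right (c : Ordinal.{0}) : StrictMono (hessenbergSum c) := by
  intro a b hab
  rw [hessenbergSum_comm c, hessenbergSum_comm c]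
  exact hessenbergSum_strictMono_left c hab

theorem hessenbergSum_le_hessenbergSum {a b c d : Ordinal.{0}} (hac : a ≤ c) (hbd : b ≤ d) :
    hessenbergSum a b ≤ hessenbergSum c d :=
  ((hessenbergSum_strictMono_left b).monotone hac).trans
    ((hessenbergSum_strictMono_right c).monotone hbd)

theorem hessenbergSum_lt_omega0_opow {a b γ : Ordinal.{0}} (ha : a < ω ^ γ) (hb : b < ω ^ γ) :
    hessenbergSum a b < ω ^ γ := by
  refine eval_lt
    (fun x => isPrincipal_add_omega0 (coeff_omega0_lt a x) (coeff_omega0_lt b x)) fun x hx => ?_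
  by_contra! hγ
  have hpow : ω ^ γ ≤ ω ^ x := opow_le_opow_right omega0_pos hγ
  apply Finsupp.mem_support_iff.1 hx
  rw [Finsupp.add_apply, coeff_eq_zero_of_lt (ha.trans_le hpow),
    coeff_eq_zero_of_lt (hb.trans_le hpow), add_zero]

/-! ### Iterated derivations and their indices -/

section Iteration

variable {α : Type*} {D : Set α → Set α} {A : Set α}

theorem mem_iterDeriv_limit {ξ : Ordinal.{0}} (h : Order.IsSuccLimit ξ) {x : α} :
    x ∈ iterDeriv D A ξ ↔ ∀ ζ < ξ, x ∈ iterDeriv D A ζ := by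
  rw [iterDeriv_limit D A ξ h]
  simp

/-- A property that passes to derived sets and to intersections holds at every stage. -/
theorem iterDeriv_induction {P : Set α → Prop} (hA : P A) (hD : ∀ B, P B → P (D B))
    (hInter : ∀ 𝒮 : Set (Set α), (∀ B ∈ 𝒮, P B) → P (⋂₀ 𝒮)) (ξ : Ordinal.{0}) :
    P (iterDeriv D A ξ) := by
  induction ξ using Ordinal.limitRecOn with
  | zero => rwa [iterDeriv_zero]
  | add_one ξ ih => rw [iterDeriv_add_one]; exact hD _ ih
  | limit ξ hξ ih =>
    rw [iterDeriv_limit D A ξ hξ, ← Set.sInter_range]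
    apply hInter
    rintro _ ⟨ζ, rfl⟩
    exact ih ζ.1 ζ.2

theorem iterDeriv_antitone_of_subset
    (h : ∀ ξ, D (iterDeriv D A ξ) ⊆ iterDeriv D A ξ) : Antitone (iterDeriv D A) := by
  intro ζ ξ hζξ
  induction ξ using Ordinal.limitRecOn with
  | zero => rw [le_antisymm hζξ zero_le]
  | add_one ξ ih =>
    rcases hζξ.eq_or_lt with rfl | hlt
    · exact le_rfl
    · rw [iterDeriv_add_one]
      exact (h ξ).trans (ih (Order.lt_add_one_iff.1 hlt))
  | limit ξ hξ ih =>
    rcases hζξ.eq_or_lt with rfl | hlt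
    · exact le_rfl
    · exact fun x hx => (mem_iterDeriv_limit hξ).1 hx ζ hlt

/-- A point that is eventually removed has a rank: the last stage to which it belongs. -/
theorem exists_rank {x : α} (hx : x ∈ A) {ξ : Ordinal.{0}}
    (hξ : x ∉ iterDeriv D A ξ) :
    ∃ a < ξ, x ∈ iterDeriv D A a ∧ x ∉ iterDeriv D A (a + 1) := by
  induction ξ using Ordinal.limitRecOn with
  | zero => rw [iterDeriv_zero] at hξ; exact absurd hx hξ
  | add_one ξ ih =>
    by_cases h : x ∈ iterDeriv D A ξ
    · exact ⟨ξ, Order.lt_add_one_iff.2 le_rfl, h, hξ⟩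
    · obtain ⟨a, ha, h'⟩ := ih h
      exact ⟨a, ha.trans (Order.lt_add_one_iff.2 le_rfl), h'⟩
  | limit ξ hlim ih =>
    rw [mem_iterDeriv_limit hlim] at hξ
    push Not at hξ
    obtain ⟨ζ, hζ, hx'⟩ := hξ
    obtain ⟨a, ha, h'⟩ := ih ζ hζ hx'
    exact ⟨a, ha.trans hζ, h'⟩

theorem derivIndex_le_omega_one : derivIndex D A ≤ ω₁ :=
  csInf_le' (Set.mem_insert _ _)

theorem derivIndex_le {ξ : Ordinal.{0}} (h : iterDeriv D A ξ = ∅) : derivIndex D A ≤ ξ := by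
  rcases lt_or_ge ξ ω₁ with hξ | hξ
  · exact csInf_le' (Set.mem_insert_of_mem _ ⟨hξ, h⟩)
  · exact derivIndex_le_omega_one.trans hξ

theorem iterDeriv_derivIndex (h : derivIndex D A < ω₁) :
    iterDeriv D A (derivIndex D A) = ∅ := by
  have hmem : derivIndex D A ∈ insert ω₁ {ξ : Ordinal.{0} | ξ < ω₁ ∧ iterDeriv D A ξ = ∅} :=
    csInf_mem (Set.insert_nonempty _ _)
  rcases hmem with h' | h'
  · exact absurd h' h.ne
  · exact h'.2

theorem lt_derivIndex (hanti : Antitone (iterDeriv D A)) {ξ : Ordinal.{0}} (hξ : ξ < ω₁)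
    (h : (iterDeriv D A ξ).Nonempty) : ξ < derivIndex D A := by
  by_contra! hle
  have hempty := iterDeriv_derivIndex (hle.trans_lt hξ)
  exact (h.mono (hanti hle)).ne_empty hempty

theorem derivIndex_le_derivIndex {β : Type*} {D' : Set β → Set β} {B : Set β}
    (h : ∀ ξ, iterDeriv D' B ξ = ∅ → iterDeriv D A ξ = ∅) :
    derivIndex D A ≤ derivIndex D' B := by
  rcases (derivIndex_le_omega_one (D := D') (A := B)).eq_or_lt with heq | hlt
  · rw [heq]; exact derivIndex_le_omega_one
  · exact derivIndex_le (h _ (iterDeriv_derivIndex hlt))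

end Iteration

/-! ### Trees of finite sequences and two-colorings -/

section Trees

variable {α : Type*} {σ : Set (ℕ → α)} {H A B : Set (List α)}

/-- The subsequence of `t` formed by the terms whose label in `l` is `c`. -/
def labelled (c : Bool) (t : List α) (l : List Bool) : List α :=
  ((t.zip l).filter fun p => p.2 = c).map Prod.fst

theorem labelled_append (c : Bool) {t : List α} {l : List Bool} (h : l.length = t.length)
    (x : α) (e : Bool) :
    labelled c (t ++ [x]) (l ++ [e]) = labelled c t l ++ if e = c then [x] else [] := by
  rw [labelled, List.zip_append h.symm, List.filter_append, List.map_append, labelled]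
  by_cases hec : e = c <;> simp [hec]

theorem iterDeriv_seqDeriv_antitone : Antitone (iterDeriv (seqDeriv σ) A) :=
  iterDeriv_antitone_of_subset fun _ _ h => h.1

theorem iterDeriv_seqDeriv_sublist (hA : ∀ t ∈ A, ∀ u, u.Sublist t → u ∈ A) (ξ : Ordinal.{0}) :
    ∀ t ∈ iterDeriv (seqDeriv σ) A ξ, ∀ u, u.Sublist t → u ∈ iterDeriv (seqDeriv σ) A ξ := by
  refine iterDeriv_induction (P := fun B => ∀ t ∈ B, ∀ u : List α, u.Sublist t → u ∈ B) hA ?_ ?_ ξ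
  · rintro B hB t ⟨ht, s, hs, hts⟩ u hu
    exact ⟨hB t ht u hu, s, hs, fun i => hB _ (hts i) _ (hu.append (List.Sublist.refl _))⟩
  · intro 𝒮 h𝒮 t ht u hu B hB
    exact h𝒮 B hB t (ht B hB) u hu

/-- If every sequence of a tree `H` splits into a part in `A` and a part in `B`, then a sequence
that survives `ξ` derivations of `H` splits into parts surviving `a` and `b` derivations, with
`ξ ≤ a ⊕ b`. At a successor stage infinitely many of the one-term extensions carry the same
labels, and along these the derivation is inherited by the part containing the new terms. -/
theorem exists_labels_of_mem_iterDeriv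
    (hσ : ∀ s ∈ σ, ∀ φ : ℕ → ℕ, StrictMono φ → s ∘ φ ∈ σ)
    (hA : ∀ t ∈ A, ∀ u, u.Sublist t → u ∈ A) (hB : ∀ t ∈ B, ∀ u, u.Sublist t → u ∈ B)
    (hH : ∀ t ∈ H, ∃ l : List Bool, l.length = t.length ∧
      labelled true t l ∈ A ∧ labelled false t l ∈ B)
    {a₀ b₀ : Ordinal.{0}} (ha₀ : iterDeriv (seqDeriv σ) A a₀ = ∅)
    (hb₀ : iterDeriv (seqDeriv σ) B b₀ = ∅) (ξ : Ordinal.{0}) :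
    ∀ t ∈ iterDeriv (seqDeriv σ) H ξ, ∃ l : List Bool, l.length = t.length ∧
      ∃ a b, ξ ≤ hessenbergSum a b ∧ labelled true t l ∈ iterDeriv (seqDeriv σ) A a ∧
        labelled false t l ∈ iterDeriv (seqDeriv σ) B b := by
  have finLabels (n : ℕ) : {l : List Bool | l.length = n}.Finite := List.finite_length_eq Bool n
  induction ξ using Ordinal.limitRecOn with
  | zero =>
    intro t ht
    rw [iterDeriv_zero] at ht
    obtain ⟨l, hl, h1, h2⟩ := hH t ht
    exact ⟨l, hl, 0, 0, zero_le, by rwa [iterDeriv_zero], by rwa [iterDeriv_zero]⟩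
  | add_one ξ ih =>
    intro t ht
    rw [iterDeriv_add_one] at ht
    obtain ⟨-, s, hs, hts⟩ := ht
    have key (i : ℕ) : ∃ l : List Bool, l.length = t.length ∧ ∃ e : Bool, ∃ a b,
        ξ ≤ hessenbergSum a b ∧
        (labelled true t l ++ if e = true then [s i] else []) ∈ iterDeriv (seqDeriv σ) A a ∧
        (labelled false t l ++ if e = false then [s i] else []) ∈ iterDeriv (seqDeriv σ) B b := by
      obtain ⟨l, hl, a, b, hab, h1, h2⟩ := ih _ (hts i)
      rcases List.eq_nil_or_concat l with rfl | ⟨l', e, rfl⟩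
      · simp at hl
      · have hl' : l'.length = t.length := by simpa using hl
        rw [List.concat_eq_append, labelled_append _ hl'] at h1 h2
        exact ⟨l', hl', e, a, b, hab, h1, h2⟩
    choose l hl e a b hab h1 h2 using key
    have := (finLabels t.length).to_subtype
    obtain ⟨⟨⟨l', hl'⟩, e'⟩, hinf⟩ := Finite.exists_infinite_fiber
      fun i => ((⟨l i, hl i⟩ : {l : List Bool | l.length = t.length}), e i)
    have hfreq : ∃ᶠ i in Filter.atTop, l i = l' ∧ e i = e' := by
      rw [Nat.frequently_atTop_iff_infinite]
      refine (Set.infinite_coe_iff.1 hinf).mono fun i hi => ?_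
      simpa using hi
    obtain ⟨φ, hφ, hφl⟩ := Filter.extraction_of_frequently_atTop hfreq
    have h1' (i) := h1 (φ i)
    have h2' (i) := h2 (φ i)
    simp only [(hφl _).1, (hφl _).2] at h1' h2'
    refine ⟨l', hl', ?_⟩
    cases e' with
    | true =>
      simp only [if_true, Bool.true_eq_false, if_false, List.append_nil] at h1' h2'
      -- the pair with the smallest `a` serves all extensions, since stages decrease
      obtain ⟨i₀, hi₀⟩ : ∃ i, ∀ j, a (φ i) ≤ a (φ j) :=
        (WellFounded.has_min (InvImage.wf (fun i => a (φ i)) Ordinal.lt_wf)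
          Set.univ ⟨0, trivial⟩).imp fun i hi j => not_lt.1 (hi.2 j trivial)
      have hmem (i) := iterDeriv_seqDeriv_antitone (hi₀ i) (h1' i)
      refine ⟨a (φ i₀) + 1, b (φ i₀), ?_, ?_, h2' i₀⟩
      · exact Order.add_one_le_of_lt ((hab (φ i₀)).trans_lt
          (hessenbergSum_strictMono_left _ (Order.lt_add_one_iff.2 le_rfl)))
      · rw [iterDeriv_add_one]
        exact ⟨iterDeriv_seqDeriv_sublist hA _ _ (hmem 0) _ (List.sublist_append_left _ _),
          s ∘ φ, hσ s hs φ hφ, hmem⟩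
    | false =>
      simp only [Bool.false_eq_true, if_true, if_false, List.append_nil] at h1' h2'
      obtain ⟨i₀, hi₀⟩ : ∃ i, ∀ j, b (φ i) ≤ b (φ j) :=
        (WellFounded.has_min (InvImage.wf (fun i => b (φ i)) Ordinal.lt_wf)
          Set.univ ⟨0, trivial⟩).imp fun i hi j => not_lt.1 (hi.2 j trivial)
      have hmem (i) := iterDeriv_seqDeriv_antitone (hi₀ i) (h2' i)
      refine ⟨a (φ i₀), b (φ i₀) + 1, ?_, h1' i₀, ?_⟩
      · exact Order.add_one_le_of_lt ((hab (φ i₀)).trans_lt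
          (hessenbergSum_strictMono_right _ (Order.lt_add_one_iff.2 le_rfl)))
      · rw [iterDeriv_add_one]
        exact ⟨iterDeriv_seqDeriv_sublist hB _ _ (hmem 0) _ (List.sublist_append_left _ _),
          s ∘ φ, hσ s hs φ hφ, hmem⟩
  | limit ξ hξ ih =>
    intro t ht
    rw [mem_iterDeriv_limit hξ] at ht
    by_contra! hcon
    -- each labelling is excluded from some stage below `ξ` on, and there are finitely many
    have bound (l : List Bool) (hl : l.length = t.length) : ∃ ζ < ξ, ∀ a b,
        labelled true t l ∈ iterDeriv (seqDeriv σ) A a →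
        labelled false t l ∈ iterDeriv (seqDeriv σ) B b → hessenbergSum a b ≤ ζ := by
      by_cases hmem : labelled true t l ∈ A ∧ labelled false t l ∈ B
      · obtain ⟨a, -, ha, ha'⟩ := exists_rank hmem.1
          (ha₀ ▸ Set.notMem_empty _)
        obtain ⟨b, -, hb, hb'⟩ := exists_rank hmem.2
          (hb₀ ▸ Set.notMem_empty _)
        refine ⟨hessenbergSum a b, ?_, fun c d hc hd => ?_⟩
        · by_contra! hle
          exact hcon l hl a b hle ha hb
        · apply hessenbergSum_le_hessenbergSum
          · by_contra! hlt
            exact ha' (iterDeriv_seqDeriv_antitone (Order.add_one_le_of_lt hlt) hc)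
          · by_contra! hlt
            exact hb' (iterDeriv_seqDeriv_antitone (Order.add_one_le_of_lt hlt) hd)
      · refine ⟨0, hξ.bot_lt, fun c d hc hd => absurd ⟨?_, ?_⟩ hmem⟩
        · simpa only [iterDeriv_zero] using iterDeriv_seqDeriv_antitone zero_le hc
        · simpa only [iterDeriv_zero] using iterDeriv_seqDeriv_antitone zero_le hd
    choose! ζ hζ hbound using bound
    have hsup : (finLabels t.length).toFinset.sup ζ < ξ := by
      rw [Finset.sup_lt_iff hξ.bot_lt]
      intro l hl
      exact hζ l (by simpa using hl)
    have hlt := hξ.add_one_lt hsup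
    obtain ⟨l, hl, a, b, hab, h1, h2⟩ := ih _ hlt t (ht _ hlt)
    have h3 : ζ l ≤ (finLabels t.length).toFinset.sup ζ := Finset.le_sup (by simpa using hl)
    exact (Order.lt_add_one_iff.2 h3).not_ge (hab.trans (hbound l hl a b h1 h2))

/-- The index of a tree whose sequences split into a part in `A` and a part in `B` is at most the
Hessenberg sum of the indices of `A` and `B`. -/
theorem derivIndex_seqDeriv_le_hessenbergSum
    (hσ : ∀ s ∈ σ, ∀ φ : ℕ → ℕ, StrictMono φ → s ∘ φ ∈ σ)
    (hA : ∀ t ∈ A, ∀ u, u.Sublist t → u ∈ A) (hB : ∀ t ∈ B, ∀ u, u.Sublist t → u ∈ B)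
    (hH : ∀ t ∈ H, ∃ l : List Bool, l.length = t.length ∧
      labelled true t l ∈ A ∧ labelled false t l ∈ B) :
    derivIndex (seqDeriv σ) H ≤
      hessenbergSum (derivIndex (seqDeriv σ) A) (derivIndex (seqDeriv σ) B) := by
  rcases (derivIndex_le_omega_one (D := seqDeriv σ) (A := A)).eq_or_lt with hA₁ | hA₁
  · exact derivIndex_le_omega_one.trans
      (hA₁ ▸ (hessenbergSum_strictMono_left _).le_apply)
  rcases (derivIndex_le_omega_one (D := seqDeriv σ) (A := B)).eq_or_lt with hB₁ | hB₁
  · exact derivIndex_le_omega_one.trans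
      (hB₁ ▸ (hessenbergSum_strictMono_right _).le_apply)
  have ha₀ := iterDeriv_derivIndex hA₁
  have hb₀ := iterDeriv_derivIndex hB₁
  refine derivIndex_le (Set.eq_empty_of_forall_notMem fun t ht => ?_)
  obtain ⟨l, -, a, b, hab, h1, h2⟩ := exists_labels_of_mem_iterDeriv hσ hA hB hH ha₀ hb₀ _ t ht
  have ha : a < derivIndex (seqDeriv σ) A := by
    by_contra! h
    exact Set.notMem_empty _ (ha₀ ▸ iterDeriv_seqDeriv_antitone h h1)
  have hb : b < derivIndex (seqDeriv σ) B := by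
    by_contra! h
    exact Set.notMem_empty _ (hb₀ ▸ iterDeriv_seqDeriv_antitone h h2)
  exact (hab.trans_lt ((hessenbergSum_strictMono_left _ ha).trans
    (hessenbergSum_strictMono_right _ hb))).false

end Trees

section BallTree

variable {X : Type*} [NormedAddCommGroup X] [NormedSpace ℝ X]

theorem ballTree_sublist {K : Set (StrongDual ℝ X)} {ε : ℝ} :
    ∀ t ∈ ballTree K ε, ∀ u : List X, u.Sublist t → u ∈ ballTree K ε := by
  rintro t ⟨ht, f, hf, hft⟩ u hu
  exact ⟨fun x hx => ht x (hu.subset hx), f, hf, fun x hx => hft x (hu.subset hx)⟩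

/-- If `f + g ≥ ε` at a point, then one of `f`, `g` is at least `ε / 2` there; this labels the
sequences of the tree of a sum of sets. -/
theorem nullIndex_ballTree_add_le (K L S : Set (StrongDual ℝ X)) (ε : ℝ) :
    nullIndex S (ballTree (K + L) ε) ≤
      hessenbergSum (nullIndex S (ballTree K (ε / 2))) (nullIndex S (ballTree L (ε / 2))) := by
  classical
  refine derivIndex_seqDeriv_le_hessenbergSum ?_ ballTree_sublist ballTree_sublist ?_
  · rintro s ⟨hs, hs'⟩ φ hφ
    exact ⟨fun n => hs _, fun f hf => (hs' f hf).comp hφ.tendsto_atTop⟩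
  · rintro t ⟨ht, _, ⟨f, hf, g, hg, rfl⟩, hfg⟩
    have hzip (u : List X) : u.zip (u.map fun x => decide (ε / 2 ≤ f x)) =
        u.map fun x => (x, decide (ε / 2 ≤ f x)) := by
      induction u <;> simp_all
    have hmem (c : Bool) (x : X) (hx : x ∈ labelled c t (t.map fun x => decide (ε / 2 ≤ f x))) :
        x ∈ t ∧ decide (ε / 2 ≤ f x) = c := by
      rw [labelled, hzip] at hx
      simpa using hx
    refine ⟨t.map fun x => decide (ε / 2 ≤ f x), by simp, ⟨fun x hx => ht x (hmem _ x hx).1, f, hf,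
      fun x hx => by simpa using (hmem _ x hx).2⟩, ⟨fun x hx => ht x (hmem _ x hx).1, g, hg,
      fun x hx => ?_⟩⟩
    have h1 := hfg x (hmem _ x hx).1
    have h2 := (hmem _ x hx).2
    simp only [decide_eq_false_iff_not, not_le] at h2
    simp only [add_apply] at h1
    linarith

end BallTree

/-! ### Diameter derivations on topological spaces -/

/-- The derivation removing the points that have a neighborhood in which all mutual distances of
points of `L` are at most `ε`. The distance `d` is unrelated to the topology, and is a bare
function so that it can be the dual norm distance while the topology is the weak* one. -/
def diamDeriv {α : Type*} [TopologicalSpace α] (d : α → α → ℝ) (ε : ℝ) (L : Set α) : Set α :=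
  {x | ∀ V ∈ 𝓝 x, ∃ y ∈ V ∩ L, ∃ z ∈ V ∩ L, ε < d y z}

section DiamDeriv

variable {α β : Type*} [TopologicalSpace α] [TopologicalSpace β]
  {d : α → α → ℝ} {d' : β → β → ℝ} {ε ε' : ℝ} {A : Set α} {B : Set β}

theorem diamDeriv_mono {A' : Set α} (h : A ⊆ A') : diamDeriv d ε A ⊆ diamDeriv d ε A' := by
  intro x hx V hV
  obtain ⟨y, hy, z, hz, hyz⟩ := hx V hV
  exact ⟨y, ⟨hy.1, h hy.2⟩, z, ⟨hz.1, h hz.2⟩, hyz⟩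

theorem isClosed_diamDeriv : IsClosed (diamDeriv d ε A) := by
  rw [← isOpen_compl_iff, isOpen_iff_mem_nhds]
  intro x hx
  simp only [diamDeriv, Set.mem_compl_iff, Set.mem_ofPred_eq] at hx
  push Not at hx
  obtain ⟨V, hV, hVd⟩ := hx
  filter_upwards [eventually_mem_nhds_iff.2 hV] with y hy hyd
  obtain ⟨u, hu, v, hv, huv⟩ := hyd V hy
  exact (hVd u hu v hv).not_gt huv

theorem diamDeriv_subset (hA : IsClosed A) : diamDeriv d ε A ⊆ A := by
  intro x hx
  rw [← hA.closure_eq, mem_closure_iff_nhds]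
  intro V hV
  obtain ⟨y, hy, -⟩ := hx V hV
  exact ⟨y, hy⟩

theorem isClosed_iterDeriv_diamDeriv (hA : IsClosed A) (ξ : Ordinal.{0}) :
    IsClosed (iterDeriv (diamDeriv d ε) A ξ) :=
  iterDeriv_induction hA (fun _ _ => isClosed_diamDeriv) (fun _ => isClosed_sInter) ξ

theorem iterDeriv_diamDeriv_antitone (hA : IsClosed A) :
    Antitone (iterDeriv (diamDeriv d ε) A) :=
  iterDeriv_antitone_of_subset fun ξ => diamDeriv_subset (isClosed_iterDeriv_diamDeriv hA ξ)

theorem iterDeriv_diamDeriv_subset (hA : IsClosed A) (ξ : Ordinal.{0}) :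
    iterDeriv (diamDeriv d ε) A ξ ⊆ A := by
  simpa only [iterDeriv_zero] using
    iterDeriv_diamDeriv_antitone (d := d) (ε := ε) hA (zero_le (a := ξ))

/-- A continuous map that keeps `ε`-separated points `ε'`-separated maps the derived sets of `A`
into those of any stage of `B` containing the image of `A`. -/
theorem mapsTo_iterDeriv_diamDeriv {φ : α → β} (hφ : Continuous φ) (hB : IsClosed B)
    (hsep : ∀ x y, ε < d x y → ε' < d' (φ x) (φ y)) {η : Ordinal.{0}}
    (hAB : Set.MapsTo φ A (iterDeriv (diamDeriv d' ε') B η)) (ξ : Ordinal.{0}) :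
    Set.MapsTo φ (iterDeriv (diamDeriv d ε) A ξ) (iterDeriv (diamDeriv d' ε') B (η + ξ)) := by
  induction ξ using Ordinal.limitRecOn with
  | zero => rwa [iterDeriv_zero, add_zero]
  | add_one ξ ih =>
    rw [iterDeriv_add_one, ← add_assoc, iterDeriv_add_one]
    intro x hx V hV
    obtain ⟨y, hy, z, hz, hyz⟩ := hx _ (hφ.continuousAt.preimage_mem_nhds hV)
    exact ⟨φ y, ⟨hy.1, ih hy.2⟩, φ z, ⟨hz.1, ih hz.2⟩, hsep y z hyz⟩
  | limit ξ hξ ih =>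
    intro x hx
    rw [mem_iterDeriv_limit hξ] at hx
    rw [mem_iterDeriv_limit (Ordinal.isSuccLimit_add η hξ)]
    intro ζ hζ
    rcases le_total ζ η with h | h
    · refine iterDeriv_diamDeriv_antitone hB h ?_
      simpa using ih 0 hξ.bot_lt (hx 0 hξ.bot_lt)
    · obtain ⟨ρ, rfl⟩ := exists_add_of_le h
      have hρ : ρ < ξ := (add_lt_add_iff_left η).1 hζ
      exact ih ρ hρ (hx ρ hρ)

/-- For a compact set, the first empty stage is a successor. -/
theorem exists_iterDeriv_add_one_eq_empty [T2Space α] (hA : IsCompact A) (hne : A.Nonempty)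
    {ξ : Ordinal.{0}} (hξ : iterDeriv (diamDeriv d ε) A ξ = ∅) :
    ∃ a < ξ, iterDeriv (diamDeriv d ε) A (a + 1) = ∅ := by
  induction ξ using Ordinal.limitRecOn with
  | zero => rw [iterDeriv_zero] at hξ; exact absurd hξ hne.ne_empty
  | add_one ξ ih => exact ⟨ξ, Order.lt_add_one_iff.2 le_rfl, hξ⟩
  | limit ξ hlim ih =>
    have hanti := iterDeriv_diamDeriv_antitone (d := d) (ε := ε) hA.isClosed
    by_cases h : ∃ ζ < ξ, iterDeriv (diamDeriv d ε) A ζ = ∅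
    · obtain ⟨ζ, hζ, hempty⟩ := h
      obtain ⟨a, ha, ha'⟩ := ih ζ hζ hempty
      exact ⟨a, ha.trans hζ, ha'⟩
    · push Not at h
      have : Nonempty (Set.Iio ξ) := ⟨⟨0, hlim.bot_lt⟩⟩
      have hclosed := isClosed_iterDeriv_diamDeriv (d := d) (ε := ε) hA.isClosed
      have := IsCompact.nonempty_iInter_of_directed_nonempty_isCompact_isClosed
        (fun ζ : Set.Iio ξ => iterDeriv (diamDeriv d ε) A ζ.1)
        (fun x y => (le_total x y).elim (fun h => ⟨y, hanti h, subset_rfl⟩)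
          fun h => ⟨x, subset_rfl, hanti h⟩)
        (fun ζ => h ζ.1 ζ.2)
        (fun ζ => hA.of_isClosed_subset (hclosed _) (iterDeriv_diamDeriv_subset hA.isClosed _))
        (fun ζ => hclosed _)
      rw [← iterDeriv_limit _ _ ξ hlim, hξ] at this
      exact absurd rfl this.ne_empty

/-- One derivation commutes with a continuous image of a compact set, up to a change of `ε`: if no
point of the fiber over `y` survives, finitely many neighborhoods of small diameter cover the
fiber, and the rest of `A` is mapped away from `y`. -/
theorem diamDeriv_image_subset [T2Space α] [T2Space β] {T : α → β} (hT : Continuous T)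
    (hd : ∀ x y x' y', T x = T x' → d x y ≤ ε' → d x' y' ≤ ε' → d' (T y) (T y') ≤ ε)
    (hA : IsCompact A) : diamDeriv d' ε (T '' A) ⊆ T '' diamDeriv d ε' A := by
  intro w hw
  by_contra hcon
  have local_small (x : α) (hx : x ∈ A ∩ T ⁻¹' {w}) :
      ∃ V, IsOpen V ∧ x ∈ V ∧ ∀ y ∈ V ∩ A, ∀ z ∈ V ∩ A, d y z ≤ ε' := by
    have hxd : x ∉ diamDeriv d ε' A := fun h => hcon ⟨x, h, hx.2⟩
    simp only [diamDeriv, Set.mem_ofPred_eq] at hxd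
    push Not at hxd
    obtain ⟨V, hV, hVd⟩ := hxd
    obtain ⟨U, hUV, hU, hxU⟩ := mem_nhds_iff.1 hV
    exact ⟨U, hU, hxU, fun y hy z hz => hVd y ⟨hUV hy.1, hy.2⟩ z ⟨hUV hz.1, hz.2⟩⟩
  choose! V hV hxV hVd using local_small
  set U : Set α := ⋃ x ∈ A ∩ T ⁻¹' {w}, V x
  have hU : IsOpen U := isOpen_biUnion hV
  have hrest : IsClosed (T '' (A \ U)) := ((hA.diff hU).image hT).isClosed
  have hwrest : w ∉ T '' (A \ U) := by
    rintro ⟨x, ⟨hxA, hxU⟩, hxw⟩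
    exact hxU (Set.mem_biUnion (⟨hxA, hxw⟩ : x ∈ A ∩ T ⁻¹' {w}) (hxV x ⟨hxA, hxw⟩))
  obtain ⟨u, ⟨hu, y, hyA, rfl⟩, v, ⟨hv, z, hzA, rfl⟩, huv⟩ :=
    hw _ (hrest.isOpen_compl.mem_nhds hwrest)
  have near (y : α) (hyA : y ∈ A) (hy : T y ∈ (T '' (A \ U))ᶜ) :
      ∃ x ∈ A ∩ T ⁻¹' {w}, d x y ≤ ε' := by
    have hyU : y ∈ U := by
      by_contra h
      exact hy ⟨y, ⟨hyA, h⟩, rfl⟩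
    obtain ⟨x, hx, hyx⟩ := Set.mem_iUnion₂.1 hyU
    exact ⟨x, hx, hVd x hx x ⟨hxV x hx, hx.1⟩ y ⟨hyx, hyA⟩⟩
  obtain ⟨x, hx, hxy⟩ := near y hyA hu
  obtain ⟨x', hx', hxz⟩ := near z hzA hv
  exact (hd x y x' z (hx.2.trans hx'.2.symm) hxy hxz).not_gt huv

theorem iterDeriv_diamDeriv_image_subset [T2Space α] [T2Space β] {T : α → β} (hT : Continuous T)
    (hd : ∀ x y x' y', T x = T x' → d x y ≤ ε' → d x' y' ≤ ε' → d' (T y) (T y') ≤ ε)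
    (hA : IsCompact A) (ξ : Ordinal.{0}) :
    iterDeriv (diamDeriv d' ε) (T '' A) ξ ⊆ T '' iterDeriv (diamDeriv d ε') A ξ := by
  have hclosed := isClosed_iterDeriv_diamDeriv (d := d) (ε := ε') hA.isClosed
  have hcompact (ζ) : IsCompact (iterDeriv (diamDeriv d ε') A ζ) :=
    hA.of_isClosed_subset (hclosed ζ) (iterDeriv_diamDeriv_subset hA.isClosed ζ)
  have hanti := iterDeriv_diamDeriv_antitone (d := d) (ε := ε') hA.isClosed
  induction ξ using Ordinal.limitRecOn with
  | zero => rw [iterDeriv_zero, iterDeriv_zero]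
  | add_one ξ ih =>
    rw [iterDeriv_add_one, iterDeriv_add_one]
    exact (diamDeriv_mono ih).trans (diamDeriv_image_subset hT hd (hcompact ξ))
  | limit ξ hξ ih =>
    intro w hw
    rw [mem_iterDeriv_limit hξ] at hw
    have : Nonempty (Set.Iio ξ) := ⟨⟨0, hξ.bot_lt⟩⟩
    have hfiber : IsClosed (T ⁻¹' {w}) := isClosed_singleton.preimage hT
    obtain ⟨x, hx⟩ := IsCompact.nonempty_iInter_of_directed_nonempty_isCompact_isClosed
      (fun ζ : Set.Iio ξ => iterDeriv (diamDeriv d ε') A ζ.1 ∩ T ⁻¹' {w})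
      (fun x y => (le_total x y).elim
        (fun h => ⟨y, Set.inter_subset_inter_left _ (hanti h), subset_rfl⟩)
        fun h => ⟨x, subset_rfl, Set.inter_subset_inter_left _ (hanti h)⟩)
      (fun ζ => by
        obtain ⟨x, hx, hxw⟩ := ih ζ.1 ζ.2 (hw ζ.1 ζ.2)
        exact ⟨x, hx, hxw⟩)
      (fun ζ => (hcompact _).inter_right hfiber)
      (fun ζ => (hclosed _).inter hfiber)
    rw [Set.mem_iInter] at hx
    exact ⟨x, (mem_iterDeriv_limit hξ).2 fun ζ hζ => (hx ⟨ζ, hζ⟩).1, (hx ⟨0, hξ.bot_lt⟩).2⟩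

/-- The derived sets of a product for the maximum distance: a pair of stage `ξ` has coordinates of
stages `a` and `b` with `ξ ≤ a ⊕ b`. If the ranks `a`, `b` of the coordinates of a point satisfy
`a ⊕ b ≤ ξ`, then near that point every pair of stage `ξ` has exactly these ranks, by strict
monotonicity of `⊕`, and so lies in a product of two sets of diameter at most `ε`. -/
theorem exists_of_mem_iterDeriv_prod (hA : IsClosed A) (hB : IsClosed B) {a₀ b₀ : Ordinal.{0}}
    (ha₀ : iterDeriv (diamDeriv d ε) A a₀ = ∅) (hb₀ : iterDeriv (diamDeriv d' ε) B b₀ = ∅)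
    (ξ : Ordinal.{0}) :
    ∀ p ∈ iterDeriv (diamDeriv (fun p q : α × β => max (d p.1 q.1) (d' p.2 q.2)) ε) (A ×ˢ B) ξ,
      ∃ a b, ξ ≤ hessenbergSum a b ∧ p.1 ∈ iterDeriv (diamDeriv d ε) A a ∧
        p.2 ∈ iterDeriv (diamDeriv d' ε) B b := by
  have hantiA := iterDeriv_diamDeriv_antitone (d := d) (ε := ε) hA
  have hantiB := iterDeriv_diamDeriv_antitone (d := d') (ε := ε) hB
  have rankA (x : α) (hx : x ∈ A) : ∃ a, x ∈ iterDeriv (diamDeriv d ε) A a ∧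
      x ∉ iterDeriv (diamDeriv d ε) A (a + 1) := by
    obtain ⟨a, -, h⟩ := exists_rank hx (ha₀ ▸ Set.notMem_empty _)
    exact ⟨a, h⟩
  have rankB (x : β) (hx : x ∈ B) : ∃ b, x ∈ iterDeriv (diamDeriv d' ε) B b ∧
      x ∉ iterDeriv (diamDeriv d' ε) B (b + 1) := by
    obtain ⟨b, -, h⟩ := exists_rank hx (hb₀ ▸ Set.notMem_empty _)
    exact ⟨b, h⟩
  have leA {x : α} {a c} (h : x ∉ iterDeriv (diamDeriv d ε) A (a + 1))
      (hc : x ∈ iterDeriv (diamDeriv d ε) A c) : c ≤ a := by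
    by_contra! hlt
    exact h (hantiA (Order.add_one_le_of_lt hlt) hc)
  have leB {x : β} {b c} (h : x ∉ iterDeriv (diamDeriv d' ε) B (b + 1))
      (hc : x ∈ iterDeriv (diamDeriv d' ε) B c) : c ≤ b := by
    by_contra! hlt
    exact h (hantiB (Order.add_one_le_of_lt hlt) hc)
  induction ξ using Ordinal.limitRecOn with
  | zero =>
    intro p hp
    rw [iterDeriv_zero] at hp
    exact ⟨0, 0, zero_le, by rw [iterDeriv_zero]; exact hp.1, by rw [iterDeriv_zero]; exact hp.2⟩
  | add_one ξ ih =>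
    intro p hp
    have hpAB := iterDeriv_diamDeriv_subset (hA.prod hB) _ hp
    obtain ⟨a, ha, ha'⟩ := rankA p.1 hpAB.1
    obtain ⟨b, hb, hb'⟩ := rankB p.2 hpAB.2
    refine ⟨a, b, ?_, ha, hb⟩
    by_contra! hlt
    have hle : hessenbergSum a b ≤ ξ := Order.lt_add_one_iff.1 hlt
    obtain ⟨V, hV, hVd⟩ : ∃ V ∈ 𝓝 p.1, ∀ y ∈ V ∩ iterDeriv (diamDeriv d ε) A a,
        ∀ z ∈ V ∩ iterDeriv (diamDeriv d ε) A a, d y z ≤ ε := by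
      rw [iterDeriv_add_one] at ha'
      simpa [diamDeriv] using ha'
    obtain ⟨W, hW, hWd⟩ : ∃ W ∈ 𝓝 p.2, ∀ y ∈ W ∩ iterDeriv (diamDeriv d' ε) B b,
        ∀ z ∈ W ∩ iterDeriv (diamDeriv d' ε) B b, d' y z ≤ ε := by
      rw [iterDeriv_add_one] at hb'
      simpa [diamDeriv] using hb'
    have hV' := Filter.inter_mem hV
      ((isClosed_iterDeriv_diamDeriv (d := d) (ε := ε) hA (a + 1)).isOpen_compl.mem_nhds ha')
    have hW' := Filter.inter_mem hW
      ((isClosed_iterDeriv_diamDeriv (d := d') (ε := ε) hB (b + 1)).isOpen_compl.mem_nhds hb')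
    have exact_rank (u : α × β) (hu1 : u.1 ∉ iterDeriv (diamDeriv d ε) A (a + 1))
        (hu2 : u.2 ∉ iterDeriv (diamDeriv d' ε) B (b + 1)) (hu : u ∈ iterDeriv
          (diamDeriv (fun p q : α × β => max (d p.1 q.1) (d' p.2 q.2)) ε) (A ×ˢ B) ξ) :
        u.1 ∈ iterDeriv (diamDeriv d ε) A a ∧ u.2 ∈ iterDeriv (diamDeriv d' ε) B b := by
      obtain ⟨a', b', hab', h1, h2⟩ := ih u hu
      have ha'' := leA hu1 h1
      have hb'' := leB hu2 h2
      rcases ha''.eq_or_lt with rfl | hlt1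
      · rcases hb''.eq_or_lt with rfl | hlt2
        · exact ⟨h1, h2⟩
        · exact absurd (hessenbergSum_strictMono_right a' hlt2) (hle.trans hab').not_gt
      · exact absurd ((hessenbergSum_strictMono_left b' hlt1).trans_le
          ((hessenbergSum_strictMono_right a).monotone hb'')) (hle.trans hab').not_gt
    rw [iterDeriv_add_one] at hp
    obtain ⟨u, ⟨hu, huξ⟩, v, ⟨hv, hvξ⟩, huv⟩ := hp _ (prod_mem_nhds hV' hW')
    obtain ⟨hu1, hu2⟩ := exact_rank u hu.1.2 hu.2.2 huξ
    obtain ⟨hv1, hv2⟩ := exact_rank v hv.1.2 hv.2.2 hvξ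
    exact (max_le (hVd _ ⟨hu.1.1, hu1⟩ _ ⟨hv.1.1, hv1⟩)
      (hWd _ ⟨hu.2.1, hu2⟩ _ ⟨hv.2.1, hv2⟩)).not_gt huv
  | limit ξ hξ ih =>
    intro p hp
    have hpAB := iterDeriv_diamDeriv_subset (hA.prod hB) _ hp
    rw [mem_iterDeriv_limit hξ] at hp
    obtain ⟨a, ha, ha'⟩ := rankA p.1 hpAB.1
    obtain ⟨b, hb, hb'⟩ := rankB p.2 hpAB.2
    refine ⟨a, b, ?_, ha, hb⟩
    by_contra! hlt
    have hlt' := hξ.add_one_lt hlt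
    obtain ⟨a', b', hab', h1, h2⟩ := ih _ hlt' p (hp _ hlt')
    exact (Order.lt_add_one_iff.2 le_rfl).not_ge
      (hab'.trans (hessenbergSum_le_hessenbergSum (leA ha' h1) (leB hb' h2)))

theorem iterDeriv_prod_eq_empty (hA : IsClosed A) (hB : IsClosed B) {a b : Ordinal.{0}}
    (ha : iterDeriv (diamDeriv d ε) A (a + 1) = ∅)
    (hb : iterDeriv (diamDeriv d' ε) B (b + 1) = ∅) :
    iterDeriv (diamDeriv (fun p q : α × β => max (d p.1 q.1) (d' p.2 q.2)) ε) (A ×ˢ B)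
      (hessenbergSum a b + 1) = ∅ := by
  refine Set.eq_empty_of_forall_notMem fun p hp => ?_
  obtain ⟨a', b', hab', h1, h2⟩ := exists_of_mem_iterDeriv_prod hA hB ha hb _ p hp
  have ha' : a' ≤ a := by
    by_contra! h
    exact Set.notMem_empty _
      (ha ▸ iterDeriv_diamDeriv_antitone hA (Order.add_one_le_of_lt h) h1)
  have hb' : b' ≤ b := by
    by_contra! h
    exact Set.notMem_empty _
      (hb ▸ iterDeriv_diamDeriv_antitone hB (Order.add_one_le_of_lt h) h2)
  exact (Order.lt_add_one_iff.2 le_rfl).not_ge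
    (hab'.trans (hessenbergSum_le_hessenbergSum ha' hb'))

end DiamDeriv

/-! ### The Szlenk index of sets of functionals -/

section Szlenk

variable {X Y V : Type*} [NormedAddCommGroup X] [NormedSpace ℝ X]
  [NormedAddCommGroup Y] [NormedSpace ℝ Y] [NormedAddCommGroup V] [NormedSpace ℝ V]

/-- The dual norm distance on the weak* dual. -/
noncomputable def dualDist (f g : WeakDual ℝ X) : ℝ :=
  ‖WeakDual.toStrongDual f - WeakDual.toStrongDual g‖

theorem szlenkDeriv_eq_preimage {ε : ℝ} (hε : 0 ≤ ε) (L : Set (StrongDual ℝ X)) :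
    szlenkDeriv ε L =
      StrongDual.toWeakDual ⁻¹' diamDeriv dualDist ε (StrongDual.toWeakDual '' L) := by
  ext f
  simp only [szlenkDeriv, diamDeriv, Set.mem_ofPred_eq, Set.mem_preimage]
  refine forall₂_congr fun V _ => ?_
  simp only [Metric.ediam, lt_iSup_iff, exists_prop, edist_dist,
    ENNReal.ofReal_lt_ofReal_iff_of_nonneg hε, dist_eq_norm]
  constructor
  · rintro ⟨y, hy, z, hz, h⟩
    exact ⟨y.toWeakDual, ⟨hy.1, y, hy.2, rfl⟩, z.toWeakDual, ⟨hz.1, z, hz.2, rfl⟩, h⟩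
  · rintro ⟨_, ⟨hyV, y, hy, rfl⟩, _, ⟨hzV, z, hz, rfl⟩, h⟩
    exact ⟨y, ⟨hyV, hy⟩, z, ⟨hzV, hz⟩, h⟩

theorem iterDeriv_szlenkDeriv {ε : ℝ} (hε : 0 ≤ ε) (L : Set (StrongDual ℝ X)) (ξ : Ordinal.{0}) :
    iterDeriv (szlenkDeriv ε) L ξ = StrongDual.toWeakDual ⁻¹'
      iterDeriv (diamDeriv dualDist ε) (StrongDual.toWeakDual '' L) ξ := by
  induction ξ using Ordinal.limitRecOn with
  | zero =>
    rw [iterDeriv_zero, iterDeriv_zero,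
      Set.preimage_image_eq _ StrongDual.toWeakDual.injective]
  | add_one ξ ih =>
    rw [iterDeriv_add_one, iterDeriv_add_one, szlenkDeriv_eq_preimage hε, ih,
      Set.image_preimage_eq _ StrongDual.toWeakDual.surjective]
  | limit ξ hξ ih =>
    ext f
    rw [mem_iterDeriv_limit hξ, Set.mem_preimage, mem_iterDeriv_limit hξ]
    refine forall₂_congr fun ζ hζ => ?_
    rw [ih ζ hζ, Set.mem_preimage]

theorem iterDeriv_szlenkDeriv_eq_empty_iff {ε : ℝ} (hε : 0 ≤ ε) {L : Set (StrongDual ℝ X)}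
    {ξ : Ordinal.{0}} : iterDeriv (szlenkDeriv ε) L ξ = ∅ ↔
      iterDeriv (diamDeriv dualDist ε) (StrongDual.toWeakDual '' L) ξ = ∅ := by
  rw [iterDeriv_szlenkDeriv hε, Set.preimage_eq_empty_iff,
    StrongDual.toWeakDual.surjective.range_eq, Set.disjoint_univ]

theorem szlenkIndexAt_le_szlenkIndex {ε : ℝ} (hε : 0 < ε) (L : Set (StrongDual ℝ X)) :
    szlenkIndexAt ε L ≤ szlenkIndex L :=
  Ordinal.le_iSup (fun ε : Set.Ioi (0 : ℝ) => szlenkIndexAt ε.1 L) ⟨ε, hε⟩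

theorem szlenkIndex_le {L : Set (StrongDual ℝ X)} {ξ : Ordinal.{0}}
    (h : ∀ ε > 0, szlenkIndexAt ε L ≤ ξ) : szlenkIndex L ≤ ξ :=
  Ordinal.iSup_le fun ε => h ε.1 ε.2

theorem szlenkIndex_le_omega_one (L : Set (StrongDual ℝ X)) : szlenkIndex L ≤ ω₁ :=
  szlenkIndex_le fun _ _ => derivIndex_le_omega_one

theorem iterDeriv_szlenkIndex {L : Set (StrongDual ℝ X)} (h : szlenkIndex L < ω₁) {ε : ℝ}
    (hε : 0 < ε) : ∃ ξ ≤ szlenkIndex L,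
      iterDeriv (diamDeriv dualDist ε) (StrongDual.toWeakDual '' L) ξ = ∅ :=
  ⟨szlenkIndexAt ε L, szlenkIndexAt_le_szlenkIndex hε L,
    (iterDeriv_szlenkDeriv_eq_empty_iff hε.le).1
      (iterDeriv_derivIndex ((szlenkIndexAt_le_szlenkIndex hε L).trans_lt h))⟩

/-- A weak* continuous map between duals that keeps separated functionals uniformly separated does
not decrease Szlenk indices. -/
theorem szlenkIndex_le_szlenkIndex_of_mapsTo {K : Set (StrongDual ℝ X)} {L : Set (StrongDual ℝ Y)}
    (hL : IsWeakStarCompact L) (φ : WeakDual ℝ X → WeakDual ℝ Y) (hφ : Continuous φ)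
    (hKL : Set.MapsTo φ (StrongDual.toWeakDual '' K) (StrongDual.toWeakDual '' L))
    (hsep : ∀ ε > 0, ∃ ε' > 0, ∀ f g, ε < dualDist f g → ε' < dualDist (φ f) (φ g)) :
    szlenkIndex K ≤ szlenkIndex L := by
  refine szlenkIndex_le fun ε hε => ?_
  obtain ⟨ε', hε', h⟩ := hsep ε hε
  refine le_trans (derivIndex_le_derivIndex fun ξ hξ => ?_) (szlenkIndexAt_le_szlenkIndex hε' L)
  rw [iterDeriv_szlenkDeriv_eq_empty_iff hε.le]
  rw [iterDeriv_szlenkDeriv_eq_empty_iff hε'.le] at hξ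
  have hmaps := mapsTo_iterDeriv_diamDeriv (η := 0) hφ hL.isClosed h
    (by rwa [iterDeriv_zero]) ξ
  rw [zero_add, hξ] at hmaps
  exact Set.eq_empty_of_forall_notMem fun f hf => hmaps hf

/-- The Szlenk index of a convex set is additively indecomposable. If `f` survives `a` derivations
of `K`, then so do all midpoints of `f` and points of `K` (with `ε` halved), and these form a copy
of `K` of half the size, which can be derived further. -/
theorem isPrincipal_add_szlenkIndex {K : Set (StrongDual ℝ X)} (hK : IsWeakStarCompact K)
    (hconv : Convex ℝ K) (hlt : szlenkIndex K < ω₁) : IsPrincipal (· + ·) (szlenkIndex K) := by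
  set K' := StrongDual.toWeakDual '' K
  have hclosed : IsClosed K' := hK.isClosed
  have survives {a : Ordinal.{0}} (ha : a < szlenkIndex K) :
      ∃ ε > 0, ∃ f, f ∈ iterDeriv (diamDeriv dualDist ε) K' a := by
    obtain ⟨⟨ε, hε⟩, h⟩ := Ordinal.lt_iSup_iff.1 ha
    refine ⟨ε, hε, ?_⟩
    by_contra! hempty
    exact (derivIndex_le ((iterDeriv_szlenkDeriv_eq_empty_iff (le_of_lt hε)).2
      (Set.eq_empty_of_forall_notMem hempty))).not_gt h
  have hmid (f : WeakDual ℝ X) : Continuous fun g : WeakDual ℝ X => (2⁻¹ : ℝ) • (f + g) := by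
    fun_prop
  have hmid_dist (f g h : WeakDual ℝ X) :
      dualDist ((2⁻¹ : ℝ) • (f + g)) ((2⁻¹ : ℝ) • (f + h)) = 2⁻¹ * dualDist g h := by
    rw [dualDist, dualDist, ← map_sub, ← smul_sub, add_sub_add_left_eq_sub, map_smul, norm_smul,
      map_sub]
    norm_num
  have hmid_mem (f g : WeakDual ℝ X) (hf : f ∈ K') (hg : g ∈ K') : (2⁻¹ : ℝ) • (f + g) ∈ K' := by
    obtain ⟨f, hf, rfl⟩ := hf
    obtain ⟨g, hg, rfl⟩ := hg
    refine ⟨(2⁻¹ : ℝ) • (f + g), ?_, by simp⟩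
    rw [smul_add]
    exact hconv hf hg (by norm_num) (by norm_num) (by norm_num)
  intro a b ha hb
  obtain ⟨ε₁, hε₁, f, hf⟩ := survives ha
  obtain ⟨ε₂, hε₂, g, hg⟩ := survives hb
  set ε := min ε₁ ε₂
  have hε : 0 < ε := lt_min hε₁ hε₂
  have hεhalf : 0 < 2⁻¹ * ε := by positivity
  have sep {ε' : ℝ} (hε' : ε ≤ ε') (f g h : WeakDual ℝ X) (hgh : ε' < dualDist g h) :
      2⁻¹ * ε < dualDist ((2⁻¹ : ℝ) • (f + g)) ((2⁻¹ : ℝ) • (f + h)) := by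
    rw [hmid_dist]
    linarith
  have hstage : Set.MapsTo (fun g : WeakDual ℝ X => (2⁻¹ : ℝ) • (f + g)) K'
      (iterDeriv (diamDeriv dualDist (2⁻¹ * ε)) K' a) := by
    intro h hh
    have := mapsTo_iterDeriv_diamDeriv (η := 0) (hmid h) hclosed (sep (min_le_left ε₁ ε₂) h)
      (A := K') (fun x hx => by rw [iterDeriv_zero]; exact hmid_mem h x hh hx) a hf
    simpa only [zero_add, add_comm h f] using this
  have hab := mapsTo_iterDeriv_diamDeriv (hmid f) hclosed (sep (min_le_right ε₁ ε₂) f) hstage b hg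
  have hne : (iterDeriv (szlenkDeriv (2⁻¹ * ε)) K (a + b)).Nonempty := by
    rw [Set.nonempty_iff_ne_empty, Ne, iterDeriv_szlenkDeriv_eq_empty_iff hεhalf.le]
    exact Set.Nonempty.ne_empty ⟨_, hab⟩
  have hanti : Antitone (iterDeriv (szlenkDeriv (2⁻¹ * ε)) K) := fun ζ ξ h => by
    rw [iterDeriv_szlenkDeriv hεhalf.le, iterDeriv_szlenkDeriv hεhalf.le]
    exact Set.preimage_mono (iterDeriv_diamDeriv_antitone hclosed h)
  have hab₁ : a + b < ω₁ := isPrincipal_add_omega 1 (ha.trans hlt) (hb.trans hlt)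
  exact (lt_derivIndex hanti hab₁ hne).trans_le (szlenkIndexAt_le_szlenkIndex hεhalf K)

/-- If the derivations of a set `M` of functionals are controlled by those of the product of two
weak* compact convex sets, then so is its Szlenk index: below a power of `ω` the Hessenberg sum
that bounds the index of the product does not exceed it. -/
theorem szlenkIndex_le_max {K : Set (StrongDual ℝ X)} {L : Set (StrongDual ℝ Y)}
    {M : Set (StrongDual ℝ V)} (hK₀ : K.Nonempty) (hL₀ : L.Nonempty)
    (hK : IsWeakStarCompact K) (hL : IsWeakStarCompact L)
    (hKc : Convex ℝ K) (hLc : Convex ℝ L)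
    (hM : ∀ ε > 0, ∃ ε' > 0, ∀ ξ,
      iterDeriv (diamDeriv (fun p q : WeakDual ℝ X × WeakDual ℝ Y =>
        max (dualDist p.1 q.1) (dualDist p.2 q.2)) ε')
        ((StrongDual.toWeakDual '' K) ×ˢ (StrongDual.toWeakDual '' L)) ξ = ∅ →
      iterDeriv (diamDeriv dualDist ε) (StrongDual.toWeakDual '' M) ξ = ∅) :
    szlenkIndex M ≤ max (szlenkIndex K) (szlenkIndex L) := by
  set σ := max (szlenkIndex K) (szlenkIndex L) with hσ
  rcases lt_or_ge σ ω₁ with hσ₁ | hσ₁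
  swap
  · exact (szlenkIndex_le_omega_one M).trans hσ₁
  have hK₁ := (le_max_left _ _).trans_lt hσ₁
  have hL₁ := (le_max_right _ _).trans_lt hσ₁
  have hprin : IsPrincipal (· + ·) σ := by
    rcases max_choice (szlenkIndex K) (szlenkIndex L) with h | h
    · rw [hσ, h]; exact isPrincipal_add_szlenkIndex hK hKc hK₁
    · rw [hσ, h]; exact isPrincipal_add_szlenkIndex hL hLc hL₁
  refine szlenkIndex_le fun ε hε => ?_
  obtain ⟨ε', hε', h⟩ := hM ε hε
  obtain ⟨ξ, hξ, hξK⟩ := iterDeriv_szlenkIndex hK₁ hε'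
  obtain ⟨η, hη, hηL⟩ := iterDeriv_szlenkIndex hL₁ hε'
  obtain ⟨a, ha, haK⟩ := exists_iterDeriv_add_one_eq_empty hK (hK₀.image _) hξK
  obtain ⟨b, hb, hbL⟩ := exists_iterDeriv_add_one_eq_empty hL (hL₀.image _) hηL
  have haσ : a < σ := ha.trans_le (hξ.trans (le_max_left _ _))
  have hbσ : b < σ := hb.trans_le (hη.trans (le_max_right _ _))
  have hsum : hessenbergSum a b < σ := by
    rcases isPrincipal_add_iff_zero_or_omega0_opow.1 hprin with h0 | ⟨γ, hγ⟩
    · rw [h0] at haσ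
      exact absurd haσ not_lt_zero
    · rw [← hγ] at haσ hbσ ⊢
      exact hessenbergSum_lt_omega0_opow haσ hbσ
  refine (derivIndex_le ((iterDeriv_szlenkDeriv_eq_empty_iff hε.le).2
    (h _ (iterDeriv_prod_eq_empty hK.isClosed hL.isClosed haK hbL)))).trans ?_
  exact Order.add_one_le_of_lt hsum

theorem IsWeakStarCompact.add {K L : Set (StrongDual ℝ X)} (hK : IsWeakStarCompact K)
    (hL : IsWeakStarCompact L) : IsWeakStarCompact (K + L) := by
  rw [IsWeakStarCompact, Set.image_add]
  exact IsCompact.add hK hL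

theorem szlenkIndex_le_szlenkIndex_add {K L : Set (StrongDual ℝ X)} (hL₀ : L.Nonempty)
    (hK : IsWeakStarCompact K) (hL : IsWeakStarCompact L) :
    szlenkIndex K ≤ szlenkIndex (K + L) := by
  obtain ⟨g, hg⟩ := hL₀
  refine szlenkIndex_le_szlenkIndex_of_mapsTo (hK.add hL) (fun f => f + g.toWeakDual)
    (continuous_id.add continuous_const) ?_ fun ε hε => ⟨ε, hε, fun f f' h => ?_⟩
  · rintro _ ⟨f, hf, rfl⟩
    exact ⟨f + g, Set.add_mem_add hf hg, map_add _ _ _⟩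
  · rwa [dualDist, ← map_sub, add_sub_add_right_eq_sub, map_sub]

theorem norm_add_sub_add_le_of_add_eq {E : Type*} [SeminormedAddCommGroup E] {a b a' b' : E}
    (h : a + b = a' + b') (c d c' d' : E) :
    ‖c + d - (c' + d')‖ ≤ ‖a - c‖ + ‖b - d‖ + (‖a' - c'‖ + ‖b' - d'‖) := by
  have hdecomp : c + d - (c' + d') = a' - c' + (b' - d') - (a - c + (b - d)) := by
    rw [← add_sub_add_comm, ← add_sub_add_comm, h]
    abel
  rw [hdecomp, add_comm (‖a - c‖ + ‖b - d‖)]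
  exact (norm_sub_le _ _).trans (add_le_add (norm_add_le _ _) (norm_add_le _ _))

theorem szlenkIndex_add {K L : Set (StrongDual ℝ X)} (hK₀ : K.Nonempty) (hL₀ : L.Nonempty)
    (hK : IsWeakStarCompact K) (hL : IsWeakStarCompact L)
    (hKc : Convex ℝ K) (hLc : Convex ℝ L) :
    szlenkIndex (K + L) = max (szlenkIndex K) (szlenkIndex L) := by
  apply le_antisymm
  · refine szlenkIndex_le_max hK₀ hL₀ hK hL hKc hLc fun ε hε => ⟨ε / 4, by positivity, ?_⟩
    intro ξ hξ
    have himage : StrongDual.toWeakDual '' (K + L) =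
        (fun p : WeakDual ℝ X × WeakDual ℝ X => p.1 + p.2) ''
          ((StrongDual.toWeakDual '' K) ×ˢ (StrongDual.toWeakDual '' L)) := by
      rw [Set.image_add, Set.add_image_prod]
    rw [himage, ← Set.subset_empty_iff]
    refine (iterDeriv_diamDeriv_image_subset
      (T := fun p : WeakDual ℝ X × WeakDual ℝ X => p.1 + p.2) (by fun_prop) ?_
      (hK.prod hL) ξ).trans (by rw [hξ, Set.image_empty])
    intro p q p' q' hpp' hpq hpq'
    obtain ⟨h1, h2⟩ := max_le_iff.1 hpq
    obtain ⟨h3, h4⟩ := max_le_iff.1 hpq'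
    dsimp only [dualDist] at h1 h2 h3 h4 ⊢
    have hpp : p.1.toStrongDual + p.2.toStrongDual = p'.1.toStrongDual + p'.2.toStrongDual := by
      simpa only [map_add] using congrArg WeakDual.toStrongDual hpp'
    have := norm_add_sub_add_le_of_add_eq hpp q.1.toStrongDual q.2.toStrongDual
      q'.1.toStrongDual q'.2.toStrongDual
    simp only [map_add]
    linarith
  · refine max_le (szlenkIndex_le_szlenkIndex_add hL₀ hK hL) ?_
    rw [add_comm]
    exact szlenkIndex_le_szlenkIndex_add hK₀ hL hK

end Szlenk

/-! ### The Szlenk index of a direct sum -/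

section DirectSum

variable {W Y Z : Type*} [NormedAddCommGroup W] [NormedSpace ℝ W]
  [NormedAddCommGroup Y] [NormedSpace ℝ Y] [NormedAddCommGroup Z] [NormedSpace ℝ Z]

/-- The adjoint of a continuous linear map, as a map between weak* duals. -/
noncomputable def weakAdjoint (T : W →L[ℝ] Y) (f : WeakDual ℝ Y) : WeakDual ℝ W :=
  StrongDual.toWeakDual ((WeakDual.toStrongDual f).comp T)

theorem continuous_weakAdjoint (T : W →L[ℝ] Y) : Continuous (weakAdjoint T) :=
  WeakDual.continuous_of_continuous_eval fun w => WeakDual.eval_continuous (T w)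

theorem dualDist_weakAdjoint (T : W →L[ℝ] Y) (f g : WeakDual ℝ Y) :
    dualDist (weakAdjoint T f) (weakAdjoint T g) =
      ‖(WeakDual.toStrongDual f - WeakDual.toStrongDual g).comp T‖ := rfl

theorem mapsTo_weakAdjoint_closedBall {T : W →L[ℝ] Y} (hT : ‖T‖ ≤ 1) :
    Set.MapsTo (weakAdjoint T) (StrongDual.toWeakDual '' Metric.closedBall (0 : StrongDual ℝ Y) 1)
      (StrongDual.toWeakDual '' Metric.closedBall (0 : StrongDual ℝ W) 1) := by
  rintro _ ⟨f, hf, rfl⟩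
  refine ⟨f.comp T, ?_, rfl⟩
  rw [mem_closedBall_zero_iff] at hf ⊢
  exact (f.opNorm_comp_le T).trans (mul_le_one₀ hf (norm_nonneg _) hT)

theorem isWeakStarCompact_closedBall (r : ℝ) :
    IsWeakStarCompact (Metric.closedBall (0 : StrongDual ℝ W) r) := by
  rw [IsWeakStarCompact, LinearEquiv.image_eq_preimage_symm]
  exact WeakDual.isCompact_closedBall 0 r

/-- The Szlenk index does not increase on passing to a complemented subspace. -/
theorem spaceSzlenkIndex_le_of_rightInverse (T : W →L[ℝ] Y) (R : Y →L[ℝ] W)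
    (hTR : T.comp R = ContinuousLinearMap.id ℝ Y) :
    spaceSzlenkIndex Y ≤ spaceSzlenkIndex W := by
  -- rescaled so that the adjoint maps the unit ball to the unit ball
  set c : ℝ := ‖T‖ + 1
  have hc : 0 < c := by positivity
  have hT : ‖c⁻¹ • T‖ ≤ 1 := by
    rw [norm_smul, norm_inv, Real.norm_of_nonneg hc.le, inv_mul_le_one₀ hc]
    exact (lt_add_one _).le
  refine szlenkIndex_le_szlenkIndex_of_mapsTo (isWeakStarCompact_closedBall 1)
    (weakAdjoint (c⁻¹ • T)) (continuous_weakAdjoint _) (mapsTo_weakAdjoint_closedBall hT)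
    fun ε hε => ⟨ε / (‖c • R‖ + 1), by positivity, fun f g hfg => ?_⟩
  rw [dualDist_weakAdjoint, div_lt_iff₀ (by positivity)]
  set h := WeakDual.toStrongDual f - WeakDual.toStrongDual g
  have hh : (h.comp (c⁻¹ • T)).comp (c • R) = h := by
    ext y
    have := congrArg (fun S : Y →L[ℝ] Y => S y) hTR
    simp only [ContinuousLinearMap.comp_apply, ContinuousLinearMap.id_apply] at this
    simp [this, hc.ne']
  calc ε < ‖h‖ := hfg
    _ = ‖(h.comp (c⁻¹ • T)).comp (c • R)‖ := by rw [hh]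
    _ ≤ ‖h.comp (c⁻¹ • T)‖ * ‖c • R‖ := ContinuousLinearMap.opNorm_comp_le _ _
    _ ≤ ‖h.comp (c⁻¹ • T)‖ * (‖c • R‖ + 1) := by gcongr; exact (lt_add_one _).le

/-- The pair of adjoints of two contractions whose ranges together span the space embeds the dual
ball into the product of the dual balls. -/
theorem spaceSzlenkIndex_le_max {i : Y →L[ℝ] W} {j : Z →L[ℝ] W} (hi : ‖i‖ ≤ 1) (hj : ‖j‖ ≤ 1)
    (P : W →L[ℝ] Y) (Q : W →L[ℝ] Z) (hPQ : i.comp P + j.comp Q = ContinuousLinearMap.id ℝ W) :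
    spaceSzlenkIndex W ≤ max (spaceSzlenkIndex Y) (spaceSzlenkIndex Z) := by
  refine szlenkIndex_le_max ⟨0, by simp⟩ ⟨0, by simp⟩
    (isWeakStarCompact_closedBall 1) (isWeakStarCompact_closedBall 1) (convex_closedBall _ _)
    (convex_closedBall _ _) fun ε hε => ⟨ε / (‖P‖ + ‖Q‖ + 1), by positivity, fun ξ hξ => ?_⟩
  have hmaps := mapsTo_iterDeriv_diamDeriv (η := 0) (ε := ε) (d := dualDist)
    (ε' := ε / (‖P‖ + ‖Q‖ + 1))
    (d' := fun p q : WeakDual ℝ Y × WeakDual ℝ Z => max (dualDist p.1 q.1) (dualDist p.2 q.2))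
    (φ := fun f : WeakDual ℝ W => (weakAdjoint i f, weakAdjoint j f))
    (A := StrongDual.toWeakDual '' Metric.closedBall (0 : StrongDual ℝ W) 1)
    (B := (StrongDual.toWeakDual '' Metric.closedBall (0 : StrongDual ℝ Y) 1) ×ˢ
      (StrongDual.toWeakDual '' Metric.closedBall (0 : StrongDual ℝ Z) 1))
    ((continuous_weakAdjoint i).prodMk (continuous_weakAdjoint j))
    ((isWeakStarCompact_closedBall 1).isClosed.prod (isWeakStarCompact_closedBall 1).isClosed)
    ?_ ?_ ξ
  · rw [zero_add, hξ] at hmaps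
    exact Set.eq_empty_of_forall_notMem fun f hf => hmaps hf
  · intro f g hfg
    simp only [dualDist_weakAdjoint]
    rw [div_lt_iff₀ (by positivity)]
    set h := WeakDual.toStrongDual f - WeakDual.toStrongDual g
    have hh : h = (h.comp i).comp P + (h.comp j).comp Q := by
      ext w
      have := congrArg (fun S : W →L[ℝ] W => h (S w)) hPQ
      simpa using this.symm
    set m := max ‖h.comp i‖ ‖h.comp j‖
    have hm : 0 ≤ m := (norm_nonneg _).trans (le_max_left _ _)
    calc ε < ‖h‖ := hfg
      _ = ‖(h.comp i).comp P + (h.comp j).comp Q‖ := by rw [← hh]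
      _ ≤ ‖h.comp i‖ * ‖P‖ + ‖h.comp j‖ * ‖Q‖ := (norm_add_le _ _).trans
          (add_le_add (ContinuousLinearMap.opNorm_comp_le _ _)
            (ContinuousLinearMap.opNorm_comp_le _ _))
      _ ≤ m * ‖P‖ + m * ‖Q‖ := by
          gcongr
          · exact le_max_left _ _
          · exact le_max_right _ _
      _ ≤ m * (‖P‖ + ‖Q‖ + 1) := by linarith
  · intro f hf
    rw [iterDeriv_zero]
    exact ⟨mapsTo_weakAdjoint_closedBall hi hf, mapsTo_weakAdjoint_closedBall hj hf⟩

theorem spaceSzlenkIndex_eq_max (e : W ≃L[ℝ] Y × Z) :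
    spaceSzlenkIndex W = max (spaceSzlenkIndex Y) (spaceSzlenkIndex Z) := by
  set P : W →L[ℝ] Y := (ContinuousLinearMap.fst ℝ Y Z).comp (e : W →L[ℝ] Y × Z) with hP
  set Q : W →L[ℝ] Z := (ContinuousLinearMap.snd ℝ Y Z).comp (e : W →L[ℝ] Y × Z) with hQ
  set i : Y →L[ℝ] W := (e.symm : Y × Z →L[ℝ] W).comp (ContinuousLinearMap.inl ℝ Y Z) with hi
  set j : Z →L[ℝ] W := (e.symm : Y × Z →L[ℝ] W).comp (ContinuousLinearMap.inr ℝ Y Z) with hj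
  have hPi : P.comp i = ContinuousLinearMap.id ℝ Y := by ext y; simp [hP, hi]
  have hQj : Q.comp j = ContinuousLinearMap.id ℝ Z := by ext z; simp [hQ, hj]
  have hsum (w : W) : i (P w) + j (Q w) = w := by
    simp [hP, hQ, hi, hj, ← map_add]
  apply le_antisymm
  · set c : ℝ := ‖i‖ + ‖j‖ + 1
    have hc : 0 < c := by positivity
    refine spaceSzlenkIndex_le_max (i := c⁻¹ • i) (j := c⁻¹ • j) ?_ ?_ (c • P) (c • Q) ?_
    · rw [norm_smul, norm_inv, Real.norm_of_nonneg hc.le, inv_mul_le_one₀ hc]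
      linarith [norm_nonneg j]
    · rw [norm_smul, norm_inv, Real.norm_of_nonneg hc.le, inv_mul_le_one₀ hc]
      linarith [norm_nonneg i]
    · ext w
      simp [hc.ne', hsum]
  · exact max_le (spaceSzlenkIndex_le_of_rightInverse P i hPi)
      (spaceSzlenkIndex_le_of_rightInverse Q j hQj)

end DirectSum

theorem theorem5p6 :
    (∀ (X : Type*) [NormedAddCommGroup X] [NormedSpace ℝ X] [CompleteSpace X]
      [TopologicalSpace.SeparableSpace X] (K L S : Set (StrongDual ℝ X)) (ε : ℝ),
      0 < ε → K.Nonempty → L.Nonempty → S.Nonempty →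
      TopologicalSpace.IsSeparable K → TopologicalSpace.IsSeparable L →
      TopologicalSpace.IsSeparable S →
      IsWeakStarCompact K → IsWeakStarCompact L →
      nullIndex S (ballTree (K + L) ε) ≤
        hessenbergSum (nullIndex S (ballTree K (ε / 2))) (nullIndex S (ballTree L (ε / 2)))) ∧
    (∀ (X : Type*) [NormedAddCommGroup X] [NormedSpace ℝ X] [CompleteSpace X]
      [TopologicalSpace.SeparableSpace X] (K L : Set (StrongDual ℝ X)),
      K.Nonempty → L.Nonempty →
      TopologicalSpace.IsSeparable K → TopologicalSpace.IsSeparable L →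
      IsWeakStarCompact K → IsWeakStarCompact L → Convex ℝ K → Convex ℝ L →
      szlenkIndex (K + L) = max (szlenkIndex K) (szlenkIndex L)) ∧
    (∀ (Y Z W : Type*) [NormedAddCommGroup Y] [NormedSpace ℝ Y] [CompleteSpace Y]
      [TopologicalSpace.SeparableSpace Y] [NormedAddCommGroup Z] [NormedSpace ℝ Z]
      [CompleteSpace Z] [TopologicalSpace.SeparableSpace Z]
      [NormedAddCommGroup W] [NormedSpace ℝ W],
      Nonempty (W ≃L[ℝ] Y × Z) →
      spaceSzlenkIndex W = max (spaceSzlenkIndex Y) (spaceSzlenkIndex Z)) :=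
  ⟨fun _ _ _ _ _ K L S ε _ _ _ _ _ _ _ _ _ => nullIndex_ballTree_add_le K L S ε,
    fun _ _ _ _ _ _ _ hK₀ hL₀ _ _ hK hL hKc hLc => szlenkIndex_add hK₀ hL₀ hK hL hKc hLc,
    fun _ _ _ _ _ _ _ _ _ _ _ _ _ ⟨e⟩ => spaceSzlenkIndex_eq_max e⟩
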